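/- Theorem 5.1. Let $n>1$ and let $S,K\subset\mathbb{R}^n$ be symmetric convex bodies (compact convex sets with non-empty interior, symmetric about the origin). Let $PW_S$ be the Paley–Wiener space of all functions $$\hat F(t)=\frac{1}{(2\pi)^{n/2}}\int_{\mathbb{R}^n}e^{-it\cdot x}F(x)\,dx,\qquad t\in\mathbb{R}^n,$$ where $F\in L^2(\mathbb{R}^n)$ vanishes almost everywhere outside $S$. A countable set $\Lambda\subset\mathbb{R}^n$ is called an interpolation set for $PW_S$ if for every $c\in\ell^2(\Lambda)$ there is $f\in PW_S$ with $f(\lambda)=c(\lambda)$ for all $\lambda\in\Lambda$. Suppose that every set $\Lambda\subset\mathbb{R}^n$ with $(\Lambda-\Lambda)\cap K=\{0\}$ is an interpolation set for $PW_S$. Then $$|S|\cdot|K|>(2\pi)^n,$$ where $|\cdot|$ denotes Lebesgue measure on $\mathbb{R}^n$. -/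

import Mathlib

open MeasureTheory
open scoped Pointwise

/-- The unitary Fourier transform `t ↦ (2π)^(-n/2) ∫ e^{-i t·x} F(x) dx` on `ℝⁿ`, as a pointwise
defined function. It is only applied to integrable `F`. -/
noncomputable def unitaryFourier {n : ℕ} (F : EuclideanSpace ℝ (Fin n) → ℂ)
    (t : EuclideanSpace ℝ (Fin n)) : ℂ :=
  (((2 * Real.pi) ^ ((n : ℝ) / 2) : ℝ) : ℂ)⁻¹ *
    ∫ x, Complex.exp (-(Complex.I * ((inner ℝ t x : ℝ) : ℂ))) * F x

/-- The Paley–Wiener space of a bounded set `S ⊆ ℝⁿ`: all Fourier transforms of functions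
`F ∈ L²(ℝⁿ)` which vanish almost everywhere outside `S`. Since `S` is bounded, such an `F` is
integrable, so its Fourier transform is defined at every point. -/
def paleyWiener {n : ℕ} (S : Set (EuclideanSpace ℝ (Fin n))) :
    Set (EuclideanSpace ℝ (Fin n) → ℂ) :=
  {f | ∃ F : EuclideanSpace ℝ (Fin n) → ℂ,
    MemLp F 2 volume ∧ (∀ᵐ x, x ∉ S → F x = 0) ∧ f = unitaryFourier F}

/-- `L` is an interpolation set for the Paley–Wiener space of `S`: it is countable, and every
`c ∈ ℓ²(L)` is the restriction to `L` of a function of the space. -/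
def IsInterpolationSet {n : ℕ} (S L : Set (EuclideanSpace ℝ (Fin n))) : Prop :=
  L.Countable ∧
    ∀ c : lp (fun _ : L => ℂ) 2, ∃ f ∈ paleyWiener S, ∀ l : L, f l = c l

/-! Minkowski–Hlawka gives a lattice `M ℤⁿ` of covolume less than `|K|` that meets `K` only at the
origin. By hypothesis some `f = F̂` in the Paley–Wiener space equals `δ₀` on it. Hence `F dx`,
pushed to the torus by `x ↦ (2π)⁻¹ Mᵀ x`, has only its zeroth Fourier coefficient nonzero, so it is
a nonzero multiple of Haar measure. Since `F` lives on the compact set `S`, the image of `S` is the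
whole torus, and comparing volumes gives `(2π)ⁿ ≤ |det M| |S| < |K| |S|`.

The lattice is found by counting among the `p ^ m` congruence lattices `zⱼ ≡ aⱼ z₀` mod `p`: were
each to have a nonzero point in the scaled body, the body would contain too many integer points. -/

/-! ### Measures on the torus and covering by translates -/

open UnitAddTorus in
theorem UnitAddTorus.integral_mFourier {d : Type*} [Fintype d] (k : d → ℤ) (hk : k ≠ 0) :
    ∫ x : UnitAddTorus d, mFourier k x = 0 := by
  obtain ⟨i, hi⟩ := Function.ne_iff.mp hk
  simp only [mFourier, ContinuousMap.coe_mk]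
  rw [integral_fintype_prod_volume_eq_prod (fun i (x : UnitAddCircle) => fourier (k i) x)]
  exact Finset.prod_eq_zero (Finset.mem_univ i)
    (integral_eq_zero_of_add_right_eq_neg (fourier_add_half_inv_index hi one_pos))

/-- If the complex measure `F • μ` and the Haar measure of the torus have proportional Fourier
coefficients after pushing forward along `q`, then they have proportional integrals of all
continuous functions. -/
theorem UnitAddTorus.integral_comp_mul_eq {d X : Type*} [Fintype d] [MeasurableSpace X]
    [TopologicalSpace X] [BorelSpace X] {μ : Measure X} {q : X → UnitAddTorus d}
    (hq : Continuous q) {F : X → ℂ} (hF : Integrable F μ) {c : ℂ}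
    (hzero : ∫ x, F x ∂μ = c)
    (hne : ∀ k : d → ℤ, k ≠ 0 → ∫ x, mFourier k (q x) * F x ∂μ = 0)
    (φ : C(UnitAddTorus d, ℂ)) :
    ∫ x, φ (q x) * F x ∂μ = c * ∫ t, φ t := by
  have hint (φ : C(UnitAddTorus d, ℂ)) : Integrable (fun x => φ (q x) * F x) μ :=
    hF.bdd_mul (c := ‖φ‖) (φ.continuous.comp hq).aestronglyMeasurable
      (Filter.Eventually.of_forall fun x => φ.norm_coe_le_norm _)
  have hint' (φ : C(UnitAddTorus d, ℂ)) : Integrable (fun t => φ t) volume :=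
    φ.continuous.integrable_of_hasCompactSupport (HasCompactSupport.of_compactSpace _)
  have hvol : volume.real (Set.univ : Set (UnitAddTorus d)) = 1 := by
    simp [Measure.real, volume_pi, Measure.pi_univ]
  -- The difference of the two sides is a bounded functional that kills the characters, whose span
  -- is dense.
  let Φ : C(UnitAddTorus d, ℂ) →ₗ[ℂ] ℂ :=
    { toFun := fun φ => (∫ x, φ (q x) * F x ∂μ) - c * ∫ t, φ t
      map_add' := fun φ ψ => by
        simp only [ContinuousMap.add_apply, add_mul]
        rw [integral_add (hint φ) (hint ψ), integral_add (hint' φ) (hint' ψ)]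
        ring
      map_smul' := fun a φ => by
        simp only [ContinuousMap.smul_apply, smul_eq_mul, mul_assoc, RingHom.id_apply]
        rw [integral_const_mul, integral_const_mul]
        ring }
  let Ψ : C(UnitAddTorus d, ℂ) →L[ℂ] ℂ := Φ.mkContinuous ((∫ x, ‖F x‖ ∂μ) + ‖c‖) <| by
    intro φ
    have h1 : ‖∫ x, φ (q x) * F x ∂μ‖ ≤ ‖φ‖ * ∫ x, ‖F x‖ ∂μ := by
      rw [← integral_const_mul]
      refine norm_integral_le_of_norm_le (hF.norm.const_mul _) (.of_forall fun x => ?_)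
      rw [norm_mul]
      gcongr
      exact φ.norm_coe_le_norm _
    have h2 : ‖∫ t, φ t‖ ≤ ‖φ‖ := by
      simpa [hvol] using norm_integral_le_of_norm_le_const (μ := volume)
        (.of_forall fun t => φ.norm_coe_le_norm t)
    calc ‖Φ φ‖ ≤ ‖∫ x, φ (q x) * F x ∂μ‖ + ‖c * ∫ t, φ t‖ := norm_sub_le _ _
      _ ≤ ‖φ‖ * (∫ x, ‖F x‖ ∂μ) + ‖c‖ * ‖φ‖ := by rw [norm_mul]; gcongr
      _ = _ := by ring
  have hΨ : Set.EqOn Ψ (0 : C(UnitAddTorus d, ℂ) →L[ℂ] ℂ) (Set.range mFourier) := by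
    rintro _ ⟨k, rfl⟩
    change (∫ x, mFourier k (q x) * F x ∂μ) - c * ∫ t, mFourier k t = 0
    rcases eq_or_ne k 0 with rfl | hk
    · simp [mFourier_zero, hzero, integral_const, hvol]
    · rw [hne k hk, integral_mFourier k hk]; simp
  have hd : Dense (Submodule.span ℂ (Set.range (mFourier (d := d))) : Set C(UnitAddTorus d, ℂ)) :=
    Submodule.dense_iff_topologicalClosure_eq_top.mpr span_mFourier_closure_eq_top
  have h0 : Ψ = 0 := ContinuousLinearMap.ext_on hd hΨ
  have := DFunLike.congr_fun h0 φ
  exact sub_eq_zero.mp this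

/-- A bump function supported off the compact image of `S` would have integral zero on the left and
nonzero on the right. -/
theorem UnitAddTorus.image_eq_univ_of_integral_eq {d X : Type*} [Fintype d] [MeasurableSpace X]
    [TopologicalSpace X] [BorelSpace X] {μ : Measure X} {q : X → UnitAddTorus d}
    (hq : Continuous q) {F : X → ℂ} {S : Set X} (hS : IsCompact S)
    (hFS : ∀ᵐ x ∂μ, x ∉ S → F x = 0) {c : ℂ} (hc : c ≠ 0)
    (h : ∀ φ : C(UnitAddTorus d, ℂ), ∫ x, φ (q x) * F x ∂μ = c * ∫ t, φ t) :
    q '' S = Set.univ := by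
  by_contra hne
  obtain ⟨t, ht⟩ := (Set.ne_univ_iff_exists_notMem _).mp hne
  obtain ⟨φ, hφ0, hφ1, hφ⟩ := exists_continuous_zero_one_of_isClosed
    (hS.image hq).isClosed (isClosed_singleton (x := t)) (Set.disjoint_singleton_right.mpr ht)
  have hpos : 0 < ∫ x, φ x :=
    φ.continuous.integral_pos_of_hasCompactSupport_nonneg_nonzero
      (HasCompactSupport.of_compactSpace _) (fun x => (hφ x).1) (x := t)
      (by rw [hφ1 rfl]; exact one_ne_zero)
  have := h ⟨fun x => (φ x : ℂ), by fun_prop⟩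
  simp only [ContinuousMap.coe_mk] at this
  rw [integral_eq_zero_of_ae, integral_complex_ofReal] at this
  · exact mul_ne_zero hc (by exact_mod_cast hpos.ne') this.symm
  · filter_upwards [hFS] with x hx
    by_cases hxS : x ∈ S
    · have : φ (q x) = 0 := hφ0 (Set.mem_image_of_mem q hxS)
      simp [this]
    · simp [hx hxS]

/-- A set of representatives of the torus `ℝᵈ / ℤᵈ` has volume at least one. -/
theorem one_le_volume_of_image_coe_eq_univ {d : Type*} [Fintype d] {T : Set (d → ℝ)}
    (hT : (fun (x : d → ℝ) i => (x i : UnitAddCircle)) '' T = Set.univ) :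
    1 ≤ volume T := by
  classical
  let b := Pi.basisFun ℝ d
  have hfd := ZSpan.isAddFundamentalDomain' b volume
  have : Countable (Submodule.span ℤ (Set.range b)).toAddSubgroup :=
    inferInstanceAs (Countable (Submodule.span ℤ (Set.range b)))
  have hvol : volume (ZSpan.fundamentalDomain b) = 1 := by
    rw [ZSpan.fundamentalDomain_pi_basisFun, volume_pi_pi]; simp
  -- The lattice translates of `T` cover the unit cube.
  rw [← hvol, hfd.measure_eq_tsum T]
  refine (measure_mono ?_).trans (measure_iUnion_le _)
  intro x hx
  have hxT : (fun i => (x i : UnitAddCircle)) ∈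
      (fun (x : d → ℝ) i => (x i : UnitAddCircle)) '' T := hT ▸ Set.mem_univ _
  obtain ⟨y, hy, hxy⟩ := hxT
  have hmem : x - y ∈ Submodule.span ℤ (Set.range b) := by
    rw [b.mem_span_iff_repr_mem ℤ]
    intro i
    have h1 : ((x i - y i : ℝ) : UnitAddCircle) = 0 := by
      rw [AddCircle.coe_sub, sub_eq_zero]; exact (congrFun hxy i).symm
    obtain ⟨m, hm⟩ := (AddCircle.coe_eq_zero_iff (1 : ℝ)).mp h1
    exact ⟨m, by simpa [b] using hm⟩
  refine Set.mem_iUnion.mpr ⟨⟨x - y, hmem⟩, ?_, hx⟩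
  exact ⟨y, hy, by simp [AddSubgroup.vadd_def]⟩

/-! ### Interpolating `δ₀` on a lattice -/

/-- If the function `δ₀` on the lattice `M ℤⁿ` is the restriction of a function in the Paley–Wiener
space of `S`, then the translates of `S` by the lattice dual to `M ℤⁿ` cover the space. -/
theorem pow_two_pi_le_of_interpolates_single {n : ℕ} {S : Set (EuclideanSpace ℝ (Fin n))}
    (hS : IsCompact S) (M : Matrix (Fin n) (Fin n) ℝ)
    {f : EuclideanSpace ℝ (Fin n) → ℂ} (hf : f ∈ paleyWiener S) (hf0 : f 0 = 1)
    (hfne : ∀ k : Fin n → ℤ, k ≠ 0 → f (WithLp.toLp 2 (M.mulVec fun i => (k i : ℝ))) = 0) :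
    (2 * Real.pi) ^ n ≤ |M.det| * volume.real S := by
  obtain ⟨F, hF, hFS, rfl⟩ := hf
  have hFint : Integrable F := by
    have h1 : IntegrableOn F S :=
      have : IsFiniteMeasure (volume.restrict S) := ⟨by simpa using hS.measure_lt_top⟩
      (hF.restrict S).integrable (by norm_num)
    exact h1.integrable_of_ae_notMem_eq_zero hFS
  -- Chosen so that `⟨M k, x⟩ = 2π k · A x`: evaluating the transform at lattice points gives
  -- Fourier coefficients on the torus.
  set A : Matrix (Fin n) (Fin n) ℝ := (2 * Real.pi)⁻¹ • M.transpose with hA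
  let q : EuclideanSpace ℝ (Fin n) → UnitAddTorus (Fin n) :=
    fun x i => ((A.mulVec x.ofLp i : ℝ) : UnitAddCircle)
  have hq : Continuous q := by
    refine continuous_pi fun i => (AddCircle.continuous_mk' 1).comp ?_
    simp only [Matrix.mulVec, dotProduct]
    fun_prop
  have hπ : (2 * Real.pi : ℝ) ≠ 0 := by positivity
  have hexp (k : Fin n → ℤ) (x : EuclideanSpace ℝ (Fin n)) : UnitAddTorus.mFourier (-k) (q x) =
      Complex.exp (-(Complex.I *
        ((inner ℝ (WithLp.toLp 2 (M.mulVec fun i => (k i : ℝ))) x : ℝ) : ℂ))) := by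
    have hinner : inner ℝ (WithLp.toLp 2 (M.mulVec fun i => (k i : ℝ))) x =
        ∑ i, 2 * Real.pi * (k i * A.mulVec x.ofLp i) := by
      rw [EuclideanSpace.inner_eq_star_dotProduct]
      simp only [star_trivial]
      rw [Matrix.dotProduct_mulVec, ← Matrix.mulVec_transpose, hA, Matrix.smul_mulVec]
      simp only [dotProduct, Pi.smul_apply, smul_eq_mul]
      refine Finset.sum_congr rfl fun i _ => ?_
      field_simp
    rw [hinner]
    have hcoe (i : Fin n) : fourier ((-k) i) ((A.mulVec x.ofLp i : ℝ) : UnitAddCircle) =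
        Complex.exp (2 * Real.pi * Complex.I * (-k) i * (A.mulVec x.ofLp i : ℝ) / (1 : ℝ)) :=
      fourier_coe_apply
    simp only [UnitAddTorus.mFourier, ContinuousMap.coe_mk, q, hcoe]
    rw [← Complex.exp_sum]
    congr 1
    push_cast
    rw [Finset.mul_sum, ← Finset.sum_neg_distrib]
    refine Finset.sum_congr rfl fun i _ => ?_
    simp only [Pi.neg_apply]
    push_cast
    ring
  set a : ℂ := (((2 * Real.pi) ^ ((n : ℝ) / 2) : ℝ) : ℂ)⁻¹ with ha
  have hzero : a * ∫ x, F x = 1 := by simpa [unitaryFourier] using hf0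
  have ha0 : a ≠ 0 := fun h => by simp [h] at hzero
  have hq_univ : q '' S = Set.univ := by
    refine UnitAddTorus.image_eq_univ_of_integral_eq hq hS hFS (right_ne_zero_of_mul_eq_one hzero)
      (UnitAddTorus.integral_comp_mul_eq hq hFint rfl fun k hk => ?_)
    have := hfne (-k) (neg_ne_zero.mpr hk)
    rw [unitaryFourier] at this
    simp only [← hexp, neg_neg] at this
    exact (mul_eq_zero.mp this).resolve_left ha0
  have hT : (fun (x : Fin n → ℝ) i => (x i : UnitAddCircle)) ''
      (Matrix.toLin' A '' (WithLp.toLp 2 ⁻¹' S)) = Set.univ := by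
    rw [← hq_univ, Set.image_image]
    nth_rewrite 2 [← Set.image_preimage_eq S (WithLp.toLp_surjective 2)]
    rw [Set.image_image]
    simp [q]
  have h1 := one_le_volume_of_image_coe_eq_univ hT
  rw [Measure.addHaar_image_linearMap, LinearMap.det_toLin',
    (PiLp.volume_preserving_toLp (Fin n)).measure_preimage hS.measurableSet.nullMeasurableSet,
    ← ENNReal.ofReal_toReal hS.measure_lt_top.ne, ← ENNReal.ofReal_mul (abs_nonneg _),
    ENNReal.one_le_ofReal, hA, Matrix.det_smul, Matrix.det_transpose, Fintype.card_fin,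
    abs_mul, abs_of_pos (by positivity), inv_pow, mul_assoc] at h1
  have := mul_le_mul_of_nonneg_left h1 (show 0 ≤ (2 * Real.pi) ^ n by positivity)
  rwa [mul_one, mul_inv_cancel_left₀ (pow_ne_zero _ hπ)] at this

/-! ### Minkowski–Hlawka by congruence lattices -/

open Filter Topology

/-- If the congruence lattice `{z ∈ ℤᵐ⁺¹ : zⱼ ≡ aⱼ z₀ mod p}` meets `x • K` nontrivially for every
`a`, then `K` contains at least `2 pᵐ` points of `x⁻¹ ℤᵐ⁺¹`. -/
theorem two_mul_pow_le_card_of_forall_exists_mem {m p : ℕ} [Fact p.Prime] {K : Set (Fin (m + 1) → ℝ)}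
    (hsymm : ∀ v ∈ K, -v ∈ K) {R x : ℝ} (hR : ∀ v ∈ K, ‖v‖ ≤ R) (hx : 0 < x) (hxp : R * x < p)
    {Z : Set (Fin (m + 1) → ℝ)} (hZ : ∀ z : Fin (m + 1) → ℤ, (fun i => (z i : ℝ)) ∈ Z)
    (hfin : (K ∩ x⁻¹ • Z).Finite)
    (h : ∀ a : Fin m → ZMod p, ∃ z : Fin (m + 1) → ℤ, z ≠ 0 ∧ (x⁻¹ • fun i => (z i : ℝ)) ∈ K ∧
      ∀ j : Fin m, (z j.succ : ZMod p) = a j * z 0) :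
    2 * p ^ m ≤ Nat.card ↑(K ∩ x⁻¹ • Z) := by
  choose z hz0 hzK hza using h
  -- Otherwise `p` divides every coordinate, and all are smaller than `p` in absolute value.
  have hz : ∀ a, (z a 0 : ZMod p) ≠ 0 := by
    intro a h0
    apply hz0 a
    have hdvd : ∀ i, (p : ℤ) ∣ z a i := by
      intro i
      rw [← ZMod.intCast_zmod_eq_zero_iff_dvd]
      refine Fin.cases h0 (fun j => ?_) i
      rw [hza, h0, mul_zero]
    ext i
    refine Int.eq_zero_of_abs_lt_dvd (hdvd i) ?_
    have h1 := (norm_le_pi_norm _ i).trans (hR _ (hzK a))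
    rw [Pi.smul_apply, norm_smul, norm_inv, Real.norm_of_nonneg hx.le, inv_mul_le_iff₀ hx,
      Real.norm_eq_abs] at h1
    have h2 : |(z a i : ℝ)| < p := by linarith
    exact_mod_cast h2
  -- Each `a` yields a pair `±z`. As `z 0` is invertible mod `p`, the point determines `a`, and then
  -- the sign.
  let g : (Fin m → ZMod p) × ℤˣ → ↑(K ∩ x⁻¹ • Z) := fun as =>
    ⟨x⁻¹ • fun i => (((as.2 : ℤ) * z as.1 i : ℤ) : ℝ), by
      refine ⟨?_, Set.smul_mem_smul_set (hZ _)⟩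
      rcases Int.units_eq_one_or as.2 with h | h
      · simpa [h] using hzK as.1
      · have := hsymm _ (hzK as.1)
        rw [← smul_neg] at this
        simpa [h, Pi.neg_def] using this⟩
  have hg : Function.Injective g := by
    rintro ⟨a, s⟩ ⟨b, t⟩ hab
    have h1 : ∀ i, (s : ℤ) * z a i = t * z b i := by
      intro i
      have := congrFun (smul_right_injective _ (inv_ne_zero hx.ne') (Subtype.ext_iff.mp hab)) i
      exact_mod_cast this
    have h2 : a = b := by
      ext j
      have hs : ((s : ℤ) : ZMod p) ≠ 0 := by
        rcases Int.units_eq_one_or s with h | h <;> simp [h]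
      have e0 := congrArg (Int.cast : ℤ → ZMod p) (h1 0)
      have ej := congrArg (Int.cast : ℤ → ZMod p) (h1 j.succ)
      push_cast at e0 ej
      rw [hza, hza] at ej
      refine mul_right_cancel₀ (mul_ne_zero hs (hz a)) ?_
      linear_combination ej - b j * e0
    subst h2
    have h3 : z a 0 ≠ 0 := fun h => hz a (by simp [h])
    rw [Units.ext (mul_right_cancel₀ h3 (h1 0))]
  have := hfin.to_subtype
  have hle := Nat.card_le_card_of_injective g hg
  simpa [Nat.card_prod, mul_comm, Nat.card_eq_fintype_card] using hle

/-- The generator matrix of the lattice `η {z ∈ ℤᵐ⁺¹ : zⱼ ≡ aⱼ z₀ mod p}`. -/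
def congruenceMatrix {m : ℕ} (η : ℝ) (p : ℕ) (a : Fin m → ℤ) :
    Matrix (Fin (m + 1)) (Fin (m + 1)) ℝ :=
  η • Matrix.of (Fin.cons (Fin.cons 1 0) fun j => Fin.cons (a j : ℝ) (Pi.single j (p : ℝ)))

theorem det_congruenceMatrix {m : ℕ} (η : ℝ) (p : ℕ) (a : Fin m → ℤ) :
    (congruenceMatrix η p a).det = η ^ (m + 1) * p ^ m := by
  rw [congruenceMatrix, Matrix.det_smul, Matrix.det_of_isLowerTriangular]
  · simp [Fin.prod_univ_succ]
  · intro i j hij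
    change i < j at hij
    induction i using Fin.cases with
    | zero => obtain ⟨j, rfl⟩ := Fin.exists_succ_eq.mpr hij.ne'; simp
    | succ i =>
      obtain ⟨j, rfl⟩ := Fin.exists_succ_eq.mpr (Fin.ne_zero_of_lt hij)
      have : j ≠ i := fun h => by simp [h] at hij
      simp [this.symm]

theorem congruenceMatrix_mulVec {m : ℕ} (η : ℝ) (p : ℕ) (a : Fin m → ℤ) (k : Fin (m + 1) → ℤ) :
    (congruenceMatrix η p a).mulVec (fun i => (k i : ℝ)) =
      η • fun i => ((Fin.cons (k 0) (fun j => a j * k 0 + p * k j.succ) : Fin (m + 1) → ℤ) i : ℝ) := by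
  rw [congruenceMatrix, Matrix.smul_mulVec]
  congr 1
  ext i
  refine Fin.cases ?_ (fun j => ?_) i
  · simp [Matrix.mulVec, dotProduct, Fin.sum_univ_succ]
  · simp [Matrix.mulVec, dotProduct, Fin.sum_univ_succ, Pi.single_apply]

/-- A weak form of the **Minkowski–Hlawka theorem**: a symmetric convex body of volume `V` in
dimension at least two has a lattice of covolume less than `V` avoiding it. -/
theorem exists_matrix_forall_mulVec_mem_imp_eq_zero {m : ℕ} (hm : m ≠ 0)
    {K : Set (Fin (m + 1) → ℝ)} (hKc : IsCompact K) (hconv : Convex ℝ K)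
    (hsymm : ∀ v ∈ K, -v ∈ K) (hint : (interior K).Nonempty) :
    ∃ M : Matrix (Fin (m + 1)) (Fin (m + 1)) ℝ, M.det ≠ 0 ∧ |M.det| < volume.real K ∧
      ∀ k : Fin (m + 1) → ℤ, M.mulVec (fun i => (k i : ℝ)) ∈ K → k = 0 := by
  set V := volume.real K with hV
  have hVpos : 0 < V := ENNReal.toReal_pos
    (Measure.measure_pos_of_nonempty_interior volume hint).ne'
    hKc.measure_lt_top.ne
  obtain ⟨R, hR0, hR⟩ : ∃ R > 0, ∀ v ∈ K, ‖v‖ ≤ R := hKc.isBounded.exists_pos_norm_le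
  have h0K : (0 : Fin (m + 1) → ℝ) ∈ K := by
    obtain ⟨v, hv⟩ := hint
    have hv := interior_subset hv
    have := hconv hv (hsymm v hv) (show (0 : ℝ) ≤ 1 / 2 by norm_num)
      (show (0 : ℝ) ≤ 1 / 2 by norm_num) (by norm_num)
    simpa using this
  -- Convexity supplies the null frontier and, with `0 ∈ K`, the monotone dilates.
  have hlim := tendsto_card_div_pow_atTop_volume' K hKc.isBounded hKc.measurableSet
    (hconv.addHaar_frontier volume) (by
      rintro x y hx hxy _ ⟨v, hv, rfl⟩
      have hy := hx.trans_le hxy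
      refine ⟨(x / y) • v, hconv.smul_mem_of_zero_mem h0K hv ⟨by positivity, ?_⟩, ?_⟩
      · rwa [div_le_one hy]
      · simp only [smul_smul]; rw [mul_div_cancel₀ _ hy.ne'])
  set Z : Set (Fin (m + 1) → ℝ) :=
    (Submodule.span ℤ (Set.range (Pi.basisFun ℝ (Fin (m + 1)))) : Set (Fin (m + 1) → ℝ)) with hZdef
  have hZ (z : Fin (m + 1) → ℤ) : (fun i => (z i : ℝ)) ∈ Z := by
    rw [hZdef, SetLike.mem_coe, (Pi.basisFun ℝ (Fin (m + 1))).mem_span_iff_repr_mem ℤ]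
    exact fun i => ⟨z i, by simp⟩
  -- This makes the covolume `3/4 * V`. Any factor strictly between `1/2` and `1` would do: the body
  -- then has about `4/3 * p ^ m < 2 * p ^ m` points.
  let x : ℕ → ℝ := fun p => ((p : ℝ) ^ m / (3 / 4 * V)) ^ ((m + 1 : ℕ) : ℝ)⁻¹
  have hxpow (p : ℕ) : x p ^ (m + 1) = (p : ℝ) ^ m / (3 / 4 * V) :=
    Real.rpow_inv_natCast_pow (by positivity) (by omega)
  have hxlim : Tendsto x atTop atTop := by
    refine (tendsto_rpow_atTop (by positivity)).comp (Tendsto.atTop_div_const (by positivity) ?_)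
    exact (tendsto_pow_atTop hm).comp tendsto_natCast_atTop_atTop
  have hcard := (hlim.comp hxlim).eventually
    (Ioo_mem_nhds hVpos (show V < 3 / 2 * V by linarith))
  have hlarge : ∀ᶠ p : ℕ in atTop, R ^ (m + 1) < 3 / 4 * V * p :=
    (tendsto_natCast_atTop_atTop.const_mul_atTop (by positivity)).eventually_gt_atTop _
  obtain ⟨N, hN⟩ := eventually_atTop.mp (hcard.and hlarge)
  obtain ⟨p, hNp, hp⟩ := Nat.exists_infinite_primes N
  obtain ⟨⟨hc0, hc1⟩, hl⟩ := hN p hNp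
  have : Fact p.Prime := ⟨hp⟩
  have hp0 : (0 : ℝ) < p := by exact_mod_cast hp.pos
  have hx : 0 < x p := by positivity
  simp only [Function.comp_apply, Fintype.card_fin] at hc0 hc1
  -- For an infinite set `Nat.card` is `0`, against the positive lower bound.
  have hfin : (K ∩ (x p)⁻¹ • Z).Finite := by
    by_contra hinf
    have : Infinite ↑(K ∩ (x p)⁻¹ • Z) := Set.infinite_coe_iff.mpr hinf
    simp at hc0
  have hlt : Nat.card ↑(K ∩ (x p)⁻¹ • Z) < 2 * p ^ m := by
    rw [div_lt_iff₀ (by positivity), hxpow] at hc1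
    have : 3 / 2 * V * ((p : ℝ) ^ m / (3 / 4 * V)) = 2 * p ^ m := by field_simp; norm_num
    rw [this] at hc1
    exact_mod_cast hc1
  have hxp : R * x p < p := by
    refine lt_of_pow_lt_pow_left₀ (m + 1) hp0.le ?_
    rw [mul_pow, hxpow, ← mul_div_assoc, div_lt_iff₀ (by positivity)]
    calc R ^ (m + 1) * (p : ℝ) ^ m < 3 / 4 * V * p * p ^ m := by gcongr
      _ = _ := by ring
  have hex := mt (two_mul_pow_le_card_of_forall_exists_mem (p := p) hsymm hR hx hxp hZ hfin)
    (not_le.mpr hlt)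
  push Not at hex
  obtain ⟨a, ha⟩ := hex
  have hdet : (congruenceMatrix (x p)⁻¹ p fun j => ((a j).val : ℤ)).det = 3 / 4 * V := by
    rw [det_congruenceMatrix, inv_pow, hxpow]
    field_simp
  refine ⟨congruenceMatrix (x p)⁻¹ p fun j => ((a j).val : ℤ), ?_, ?_, fun k hk => ?_⟩
  · rw [hdet]; positivity
  · rw [hdet, abs_of_pos (by positivity)]; linarith
  · rw [congruenceMatrix_mulVec] at hk
    by_contra hk0
    have hne : (Fin.cons (k 0) (fun j => ((a j).val : ℤ) * k 0 + p * k j.succ) :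
        Fin (m + 1) → ℤ) ≠ 0 := by
      intro h
      have h0 : k 0 = 0 := by simpa using congrFun h 0
      refine hk0 (funext fun i => Fin.cases h0 (fun j => ?_) i)
      simpa [h0, hp.ne_zero] using congrFun h j.succ
    obtain ⟨j, hj⟩ := ha _ hne hk
    simp at hj

/-! ### The volume inequality -/

theorem theorem5p1 (n : ℕ) (hn : 1 < n)
    (S K : ConvexBody (EuclideanSpace ℝ (Fin n)))
    (hS_symm : ∀ x ∈ S, -x ∈ S) (hS_int : (interior (S : Set (EuclideanSpace ℝ (Fin n)))).Nonempty)
    (hK_symm : ∀ x ∈ K, -x ∈ K) (hK_int : (interior (K : Set (EuclideanSpace ℝ (Fin n)))).Nonempty)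
    (hSK : ∀ L : Set (EuclideanSpace ℝ (Fin n)),
      (L - L) ∩ (K : Set (EuclideanSpace ℝ (Fin n))) = {0} →
        IsInterpolationSet (S : Set (EuclideanSpace ℝ (Fin n))) L) :
    (2 * Real.pi) ^ n <
      volume.real (S : Set (EuclideanSpace ℝ (Fin n))) *
        volume.real (K : Set (EuclideanSpace ℝ (Fin n))) := by
  obtain ⟨m, rfl⟩ : ∃ m, n = m + 1 := ⟨n - 1, by omega⟩
  let e := (PiLp.continuousLinearEquiv 2 ℝ fun _ : Fin (m + 1) => ℝ).symm
  obtain ⟨M, hdet, hMK, hM⟩ := exists_matrix_forall_mulVec_mem_imp_eq_zero (m := m) (by omega)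
    (K := e ⁻¹' K) (e.toHomeomorph.isCompact_preimage.mpr K.isCompact)
    (K.convex.linear_preimage e.toLinearMap)
    (fun v hv => by simpa using hK_symm _ hv)
    ((hK_int.preimage e.surjective).mono
      (preimage_interior_subset_interior_preimage e.continuous))
  have hvolK : volume.real (e ⁻¹' (K : Set (EuclideanSpace ℝ (Fin (m + 1))))) =
      volume.real (K : Set (EuclideanSpace ℝ (Fin (m + 1)))) :=
    congrArg ENNReal.toReal ((PiLp.volume_preserving_toLp (Fin (m + 1))).measure_preimage
      K.isCompact.measurableSet.nullMeasurableSet)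
  rw [hvolK] at hMK
  let P : (Fin (m + 1) → ℤ) → EuclideanSpace ℝ (Fin (m + 1)) :=
    fun k => WithLp.toLp 2 (M.mulVec fun i => (k i : ℝ))
  have hP0 : P 0 = 0 := by
    have : (fun _ : Fin (m + 1) => (0 : ℝ)) = 0 := rfl
    simp [P, this]
  have hPsub (k l : Fin (m + 1) → ℤ) : P k - P l = P (k - l) := by
    rw [← WithLp.toLp_sub, ← Matrix.mulVec_sub]
    congr 2
    ext i
    simp
  have hPK {k : Fin (m + 1) → ℤ} (hk : P k ∈ K) : k = 0 := hM k hk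
  have h0K : (0 : EuclideanSpace ℝ (Fin (m + 1))) ∈ K := by
    obtain ⟨x, hx⟩ := K.nonempty
    have := K.convex hx (hK_symm x hx) (show (0 : ℝ) ≤ 1 / 2 by norm_num)
      (show (0 : ℝ) ≤ 1 / 2 by norm_num) (by norm_num)
    simpa using this
  obtain ⟨-, hL⟩ := hSK (Set.range P) (by
    refine Set.eq_singleton_iff_unique_mem.mpr ⟨⟨⟨P 0, ⟨0, rfl⟩, P 0, ⟨0, rfl⟩, by simp⟩, h0K⟩, ?_⟩
    rintro _ ⟨⟨_, ⟨k, rfl⟩, _, ⟨l, rfl⟩, rfl⟩, hmem⟩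
    simp only [hPsub] at hmem ⊢
    rw [hPK hmem, hP0])
  classical
  obtain ⟨f, hf, hfl⟩ := hL (lp.single 2 ⟨P 0, 0, rfl⟩ 1)
  have hmain := pow_two_pi_le_of_interpolates_single S.isCompact M hf
    (by simpa [hP0] using hfl ⟨P 0, 0, rfl⟩) (fun k hk => by
      rw [hfl ⟨P k, k, rfl⟩, lp.single_apply_ne]
      intro h
      apply hk
      refine hPK ?_
      rw [show P k = P 0 from congrArg Subtype.val h, hP0]
      exact h0K)
  have hSpos : 0 < volume.real (S : Set (EuclideanSpace ℝ (Fin (m + 1)))) :=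
    ENNReal.toReal_pos (Measure.measure_pos_of_nonempty_interior volume hS_int).ne'
      S.isCompact.measure_lt_top.ne
  calc (2 * Real.pi) ^ (m + 1) ≤ |M.det| * volume.real (S : Set (EuclideanSpace ℝ (Fin (m + 1)))) :=
        hmain
    _ < _ := by rw [mul_comm]; gcongr
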